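/- Let $n\ge 1$, and let $\mathbb H^n=\mathbb C^n\times\mathbb R$ be the Heisenberg group with group law $(z,t)(w,s)=\big(z+w,\;t+s+\tfrac12\,\mathrm{Im}(z\cdot\bar w)\big)$ and Lebesgue (Haar) measure $dw\,ds$. For $k=0,1,2,\dots$ let $R_k=\{(\lambda,\tau)\in\mathbb R^2:\tau=(2k+n)|\lambda|\}$, let $R_\infty=\{(0,\tau):\tau\ge 0\}$, and let the Heisenberg fan $\Omega=R_\infty\cup\bigcup_{k\ge 0}R_k\subset\mathbb R^2$ carry the Euclidean metric. For $a\in\Omega$ define $e_a:\mathbb H^n\to\mathbb C$ as follows. If $a=(\lambda,(2k+n)|\lambda|)\in R_k$ with $\lambda\neq0$, put $$e_a(z,t)=e^{i\lambda t}\,L_k^{n-1}\!\big(\tfrac12|\lambda||z|^2\big)\,e^{-\frac14|\lambda||z|^2},$$ where $L_k^{n-1}$ is the Laguerre polynomial of type $n-1$. If $a=(0,\tau)$ with $\tau\ge0$, put $$e_a(z,t)=(n-1)!\,2^{n-1}\,\frac{J_{n-1}(\sqrt\tau\,|z|)}{(\sqrt\tau\,|z|)^{n-1}},$$ where $J_{n-1}$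 is the Bessel function of order $n-1$ and the quotient $J_{n-1}(x)/x^{n-1}$ takes its limiting value $1/(2^{n-1}(n-1)!)$ at $x=0$ (so $e_{(0,0)}\equiv1$). For $f\in L^1(\mathbb H^n)$, $a\in\Omega$ and $z\in\mathbb C^n$ define the Strichartz Fourier transform by $$\widehat f(a,z)=\int_{\mathbb H^n}f(w,s)\,e_a\big((w,s)^{-1}(z,0)\big)\,dw\,ds,$$ and the normalised Strichartz Fourier transform by $$\widetilde f(a,z)=\frac{k!\,(n-1)!}{(k+n-1)!}\,\widehat f(a,z)\quad\text{for } a=(\lambda,(2k+n)|\lambda|),\ \lambda\ne0,\qquad \widetilde f(a,z)=\widehat f(a,z)\quad\text{for } a=(0,\tau),\ \tau\ge0.$$ **Theorem.** Let $f\in L^1(\mathbb H^n)$ and fix $z\in\mathbb C^n$. Then the integral defining $\widehat f(a,z)$ converges absolutely for every $a\in\Omega$, the function $a\mapsto\widetilde f(a,z)$ is uniformly continuous on $\Omega$, and $\widetilde f(a,z)\to0$ as $|a|\to\infty$, $a\in\Omega$. -/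

import Mathlib

open MeasureTheory Filter Topology
open scoped Nat

noncomputable section

/-- The underlying manifold `ℂⁿ × ℝ` of the Heisenberg group `ℍⁿ`. -/
def Heisenberg (n : ℕ) : Type := EuclideanSpace ℂ (Fin n) × ℝ

/-- The point `(z, t)` of `ℍⁿ`. -/
def Heisenberg.mk {n : ℕ} (z : EuclideanSpace ℂ (Fin n)) (t : ℝ) : Heisenberg n := (z, t)

/-- The Haar measure `dz dt`: Lebesgue measure on `ℂⁿ × ℝ`. -/
instance Heisenberg.instMeasureSpace (n : ℕ) : MeasureSpace (Heisenberg n) :=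
  inferInstanceAs (MeasureSpace (EuclideanSpace ℂ (Fin n) × ℝ))

/-- The symplectic form `Im (z · w̄)` on `ℂⁿ`. -/
def imDot {n : ℕ} (z w : EuclideanSpace ℂ (Fin n)) : ℝ :=
  (∑ j, z j * (starRingEnd ℂ) (w j)).im

/-- The group law `(z, t)(w, s) = (z + w, t + s + ½ Im (z · w̄))`, with inverse
`(z, t)⁻¹ = (-z, -t)`. -/
instance Heisenberg.instGroup (n : ℕ) : Group (Heisenberg n) where
  mul g h := (g.1 + h.1, g.2 + h.2 + (1 / 2) * imDot g.1 h.1)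
  one := (0, 0)
  inv g := (-g.1, -g.2)
  mul_assoc g h k := by
    refine Prod.ext (add_assoc g.1 h.1 k.1) ?_
    change g.2 + h.2 + (1 / 2) * imDot g.1 h.1 + k.2 + (1 / 2) * imDot (g.1 + h.1) k.1 =
      g.2 + (h.2 + k.2 + (1 / 2) * imDot h.1 k.1) + (1 / 2) * imDot g.1 (h.1 + k.1)
    simp only [imDot, PiLp.add_apply, map_add, add_mul, mul_add, Finset.sum_add_distrib,
      Complex.add_im]
    ring
  one_mul g := by
    refine Prod.ext (zero_add g.1) ?_
    change 0 + g.2 + (1 / 2) * imDot 0 g.1 = g.2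
    simp [imDot]
  mul_one g := by
    refine Prod.ext (add_zero g.1) ?_
    change g.2 + 0 + (1 / 2) * imDot g.1 0 = g.2
    simp [imDot]
  inv_mul_cancel g := by
    refine Prod.ext (neg_add_cancel g.1) ?_
    change -g.2 + g.2 + (1 / 2) * imDot (-g.1) g.1 = 0
    simp [imDot, Complex.mul_conj]

/-- The Laguerre polynomial `L_k^δ` of type `δ ∈ ℕ`,
`L_k^δ(x) = ∑_{j ≤ k} (-1)^j binom(k + δ, k - j) x^j / j!`. -/
def laguerreL (δ k : ℕ) (x : ℝ) : ℝ :=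
  ∑ j ∈ Finset.range (k + 1), (-1) ^ j * ((k + δ).choose (k - j) : ℝ) * x ^ j / (j ! : ℝ)

/-- The Bessel function `J_ν` of the first kind of order `ν ∈ ℕ`,
`J_ν(x) = ∑_m (-1)^m / (m! (m + ν)!) (x/2)^(2m + ν)`. -/
def besselJ (ν : ℕ) (x : ℝ) : ℝ :=
  ∑' m : ℕ, (-1) ^ m / ((m ! : ℝ) * ((m + ν)! : ℝ)) * (x / 2) ^ (2 * m + ν)

/-- The series defining `J_ν` converges. -/
theorem summable_besselJ (ν : ℕ) (x : ℝ) :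
    Summable fun m : ℕ => (-1) ^ m / ((m ! : ℝ) * ((m + ν)! : ℝ)) * (x / 2) ^ (2 * m + ν) := by
  refine Summable.of_norm_bounded
    ((Real.summable_pow_div_factorial ((x / 2) ^ 2)).mul_right (|x / 2| ^ ν)) fun m => ?_
  have h1 : (1 : ℝ) ≤ ((m + ν)! : ℝ) := by
    exact_mod_cast Nat.one_le_iff_ne_zero.2 (Nat.factorial_ne_zero _)
  have h0 : (0 : ℝ) < (m ! : ℝ) := by exact_mod_cast Nat.factorial_pos m
  rw [norm_mul, norm_div, norm_pow, norm_neg, norm_one, one_pow, norm_pow, Real.norm_eq_abs,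
    Real.norm_eq_abs, abs_of_pos (by positivity), pow_add, pow_mul, sq_abs, one_div, ← mul_assoc,
    div_eq_inv_mul]
  have h2 : ((m ! : ℝ) * ((m + ν)! : ℝ))⁻¹ ≤ (m ! : ℝ)⁻¹ :=
    inv_anti₀ h0 (le_mul_of_one_le_right h0.le h1)
  rw [div_eq_inv_mul _ (m ! : ℝ)]
  gcongr

/-- The function `x ↦ J_ν(x) / x^ν`, with its limit `1 / (2^ν ν!)` at the removable
singularity `x = 0`. -/
def besselQuot (ν : ℕ) (x : ℝ) : ℝ :=
  if x = 0 then 1 / (2 ^ ν * (ν ! : ℝ)) else besselJ ν x / x ^ ν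

/-- The ray `R_k = {(λ, τ) : τ = (2k + n)|λ|}`. -/
def fanRay (n k : ℕ) : Set (EuclideanSpace ℝ (Fin 2)) :=
  {a | a 1 = (2 * k + n) * |a 0|}

/-- The limiting ray `R_∞ = {(0, τ) : τ ≥ 0}`. -/
def fanLimitRay : Set (EuclideanSpace ℝ (Fin 2)) :=
  {a | a 0 = 0 ∧ 0 ≤ a 1}

/-- The Heisenberg fan `Ω`, with the Euclidean metric of `ℝ²`. -/
def heisenbergFan (n : ℕ) : Set (EuclideanSpace ℝ (Fin 2)) :=
  (⋃ k : ℕ, fanRay n k) ∪ fanLimitRay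

/-- For `a = (λ, τ)` in the fan with `λ ≠ 0`, the `k` with `a ∈ R_k`; it is
unique by `fanIndex_eq`. -/
def fanIndex (n : ℕ) (a : EuclideanSpace ℝ (Fin 2)) : ℕ :=
  sInf {k : ℕ | a ∈ fanRay n k}

theorem fanIndex_eq {n k : ℕ} {a : EuclideanSpace ℝ (Fin 2)} (ha : a ∈ fanRay n k)
    (h0 : a 0 ≠ 0) : fanIndex n a = k := by
  have h : {j : ℕ | a ∈ fanRay n j} = {k} := by
    ext j
    refine ⟨fun hj => ?_, fun hj => by rw [Set.mem_singleton_iff.1 hj]; exact ha⟩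
    have h1 : ((2 * j + n : ℝ)) * |a 0| = (2 * k + n) * |a 0| := by
      rw [← show a 1 = _ from hj, ← show a 1 = _ from ha]
    have h2 := mul_right_cancel₀ (abs_ne_zero.2 h0) h1
    have h3 : (j : ℝ) = k := by linarith
    exact_mod_cast h3
  rw [fanIndex, h, csInf_singleton]

/-- The Laguerre function
`φ_{k,λ}^{n-1}(z) = L_k^{n-1}(½ |λ| |z|²) exp (-¼ |λ| |z|²)`. -/
def laguerreFun (n k : ℕ) (lam : ℝ) (z : EuclideanSpace ℂ (Fin n)) : ℝ :=
  laguerreL (n - 1) k (1 / 2 * |lam| * ‖z‖ ^ 2) * Real.exp (-(1 / 4) * |lam| * ‖z‖ ^ 2)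

/-- The joint eigenfunction `e_{k,λ}^{n-1}(z, t) = e^{iλt} φ_{k,λ}^{n-1}(z)`. -/
def laguerreEigen (n k : ℕ) (lam : ℝ) (g : Heisenberg n) : ℂ :=
  Complex.exp (Complex.I * lam * g.2) * laguerreFun n k lam g.1

/-- The function
`χ_τ(z, t) = (n-1)! 2^{n-1} J_{n-1}(√τ |z|) / (√τ |z|)^{n-1}`. -/
def besselEigen (n : ℕ) (τ : ℝ) (g : Heisenberg n) : ℂ :=
  (((n - 1)! * 2 ^ (n - 1) * besselQuot (n - 1) (√τ * ‖g.1‖) : ℝ) : ℂ)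

/-- For `a ∈ Ω`: `e_a = e_{k,λ}^{n-1}` if `a = (λ, (2k + n)|λ|)` with `λ ≠ 0`, and
`e_a = χ_τ` if `a = (0, τ)`. -/
def fanEigen (n : ℕ) (a : EuclideanSpace ℝ (Fin 2)) (g : Heisenberg n) : ℂ :=
  if a 0 = 0 then besselEigen n (a 1) g else laguerreEigen n (fanIndex n a) (a 0) g

/-- The Strichartz Fourier transform
`f̂(a, z) = ∫ f(w, s) e_a((w, s)⁻¹(z, 0)) dw ds`, `a ∈ Ω`. -/
def strichartz {n : ℕ} (f : Heisenberg n → ℂ) (a : EuclideanSpace ℝ (Fin 2))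
    (z : EuclideanSpace ℂ (Fin n)) : ℂ :=
  ∫ g : Heisenberg n, f g * fanEigen n a (g⁻¹ * Heisenberg.mk z 0)

/-- The normalised Strichartz Fourier transform: `k! (n-1)! / (k+n-1)! · f̂(a, z)` for
`a ∈ R_k` off the limiting ray, and `f̂(a, z)` on the limiting ray. -/
def normStrichartz {n : ℕ} (f : Heisenberg n → ℂ) (a : EuclideanSpace ℝ (Fin 2))
    (z : EuclideanSpace ℂ (Fin n)) : ℂ :=
  if a 0 = 0 then strichartz f a z
  else ((((fanIndex n a)! * (n - 1)! : ℝ) / ((fanIndex n a + n - 1)! : ℝ) : ℝ) : ℂ) *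
    strichartz f a z

end

/-!
Divided by its value at the identity, `e_a` depends continuously on `a` across the limiting ray:
`L_k^d(x) / L_k^d(0) = ∑ j, (-1)^j d! / (j! (d + j)!) * ∏_{i < j} (y - i x)` with `y = k x`, and at
`x = 0` the right-hand side is the power series of the normalised Bessel function of `2 √y`.

The analytic input is a bound uniform in `k` for `u(x) = e^{-x/2} L_k^d(x) / L_k^d(0)`, with
`N = 2k + d + 1`: `u(x)` is at most a constant times `(1 + N x)^{-1/12}`. A decreasing energy bounds
`u` on `[0, N]`; a Sonin functional bounds `u^4 N x` on `[1 / N, N]` and `u^6 N` up to the turning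
point `2 N`; beyond it `u²` and eventually `x u²` decrease, so that `u^6 x` is bounded on `[N, ∞)`.
By continuity the estimate extends to the Bessel functions on the limiting ray.

For `a = (λ, τ)` one has `N x = τ |z|² / 2`, so the normalised `e_a` are uniformly bounded and tend
to `0` as `|a| → ∞` away from `z = 0`. Dominated convergence makes the transform continuous and
vanishing at infinity on the closed set `Ω`, hence uniformly continuous.
-/

noncomputable section

/-! ### Solutions of the Laguerre equation -/

/-- The energy of a solution of the Laguerre equation `x u'' + (d + 1) u' + (N / 2 - x / 4) u = 0`,
which decreases in `x`. -/
def laguerreEnergy (N : ℝ) (u : ℝ → ℝ) (x : ℝ) : ℝ :=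
  x * deriv u x ^ 2 + (N / 2 - x / 4) * u x ^ 2

/-- A Sonin functional for the Laguerre equation: `√x` times the energy
`y'² + (2N - s² + (d + 1/4) / s²) y²` of the function `y(s) = √s u(s²)` at `s = √x`. -/
def soninEnergy (d : ℕ) (N : ℝ) (u : ℝ → ℝ) (x : ℝ) : ℝ :=
  (2 * x * deriv u x + u x / 2) ^ 2 + (x * (2 * N - x) + d + 1 / 4) * u x ^ 2

theorem mul_sq_le_soninEnergy (d : ℕ) (N : ℝ) (u : ℝ → ℝ) (x : ℝ) :
    x * (2 * N - x) * u x ^ 2 ≤ soninEnergy d N u x := by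
  have hrest : 0 ≤ (2 * x * deriv u x + u x / 2) ^ 2 + (d + 1 / 4) * u x ^ 2 := by positivity
  rw [soninEnergy]
  linarith

theorem sq_mul_deriv_le_soninEnergy (d : ℕ) {N x : ℝ} (u : ℝ → ℝ) (hx : 0 ≤ x) (hxN : x ≤ 2 * N) :
    2 * (x * deriv u x) ^ 2 ≤ soninEnergy d N u x := by
  have hrest : 0 ≤ (x * (2 * N - x) + d) * u x ^ 2 := by
    have : 0 ≤ 2 * N - x := sub_nonneg.2 hxN
    positivity
  rw [soninEnergy]
  linarith [sq_nonneg (u x + 2 * x * deriv u x)]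

/-- `u` solves the equation `x u'' + (d + 1) u' + (N / 2 - x / 4) u = 0` of the Laguerre functions,
with `u 0 = 1` and rapid decay at infinity. -/
structure IsLaguerreSolution (d : ℕ) (N : ℝ) (u : ℝ → ℝ) : Prop where
  one_le : 1 ≤ N
  differentiable : Differentiable ℝ u
  differentiable_deriv : Differentiable ℝ (deriv u)
  ode : ∀ x, x * deriv (deriv u) x + (d + 1) * deriv u x + (N / 2 - x / 4) * u x = 0
  map_zero : u 0 = 1
  tendsto_pow_mul : ∀ m : ℕ, Tendsto (fun x => x ^ m * u x) atTop (𝓝 0)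
  tendsto_pow_mul_deriv : ∀ m : ℕ, Tendsto (fun x => x ^ m * deriv u x) atTop (𝓝 0)

namespace IsLaguerreSolution

variable {d : ℕ} {N x : ℝ} {u : ℝ → ℝ}

theorem pos (h : IsLaguerreSolution d N u) : 0 < N := one_pos.trans_le h.one_le

theorem inv_le (h : IsLaguerreSolution d N u) : N⁻¹ ≤ N :=
  (inv_le_one_of_one_le₀ h.one_le).trans h.one_le

theorem hasDerivAt (h : IsLaguerreSolution d N u) (x : ℝ) : HasDerivAt u (deriv u x) x :=
  (h.differentiable x).hasDerivAt

theorem hasDerivAt_deriv (h : IsLaguerreSolution d N u) (x : ℝ) :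
    HasDerivAt (deriv u) (deriv (deriv u) x) x :=
  (h.differentiable_deriv x).hasDerivAt

theorem hasDerivAt_sq (h : IsLaguerreSolution d N u) (x : ℝ) :
    HasDerivAt (fun x => u x ^ 2) (2 * (u x * deriv u x)) x :=
  ((h.hasDerivAt x).pow 2).congr_deriv (by push_cast; ring)

theorem hasDerivAt_laguerreEnergy (h : IsLaguerreSolution d N u) (x : ℝ) :
    HasDerivAt (laguerreEnergy N u) (-((2 * d + 1) * deriv u x ^ 2 + u x ^ 2 / 4)) x := by
  refine (((hasDerivAt_id' x).mul ((h.hasDerivAt_deriv x).pow 2)).add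
    ((((hasDerivAt_id' x).div_const 4).const_sub (N / 2)).mul (h.hasDerivAt_sq x))).congr_deriv ?_
  simp only [Pi.pow_apply]
  push_cast
  linear_combination 2 * deriv u x * h.ode x

theorem antitone_laguerreEnergy (h : IsLaguerreSolution d N u) : Antitone (laguerreEnergy N u) :=
  antitone_of_hasDerivAt_nonpos h.hasDerivAt_laguerreEnergy fun _ => neg_nonpos.2 (by positivity)

theorem laguerreEnergy_le (h : IsLaguerreSolution d N u) (hx : 0 ≤ x) :
    laguerreEnergy N u x ≤ N / 2 := by
  simpa [laguerreEnergy, h.map_zero] using h.antitone_laguerreEnergy hx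

theorem laguerreEnergy_nonneg (h : IsLaguerreSolution d N u) (x : ℝ) :
    0 ≤ laguerreEnergy N u x := by
  refine h.antitone_laguerreEnergy.le_of_tendsto ?_ x
  have hu := h.tendsto_pow_mul 0
  have hkinetic := (h.tendsto_pow_mul_deriv 1).mul (h.tendsto_pow_mul_deriv 0)
  have hconst := (hu.mul hu).const_mul (N / 2)
  have hlinear := ((h.tendsto_pow_mul 1).mul hu).div_const 4
  refine (((hkinetic.add hconst).sub hlinear).congr fun x => ?_).trans_eq (by simp)
  rw [laguerreEnergy]
  ring

theorem sq_le_two (h : IsLaguerreSolution d N u) (hx : 0 ≤ x) (hxN : x ≤ N) : u x ^ 2 ≤ 2 := by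
  have henergy := h.laguerreEnergy_le hx
  have hcoeff : N / 4 * u x ^ 2 ≤ (N / 2 - x / 4) * u x ^ 2 := by gcongr; linarith
  have hderiv : 0 ≤ x * deriv u x ^ 2 := by positivity
  rw [laguerreEnergy] at henergy
  refine le_of_mul_le_mul_left ?_ (show 0 < N / 4 by linarith [h.pos])
  linarith

theorem hasDerivAt_soninEnergy (h : IsLaguerreSolution d N u) (x : ℝ) :
    HasDerivAt (soninEnergy d N u)
      ((2 - 8 * d) * x * deriv u x ^ 2 + u x * deriv u x + (N - 3 * x / 2) * u x ^ 2) x := by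
  have hp : HasDerivAt (fun x => 2 * x * deriv u x + u x / 2)
      (-2 * d * deriv u x + deriv u x / 2 - (N - x / 2) * u x) x := by
    refine ((((hasDerivAt_id' x).const_mul 2).mul (h.hasDerivAt_deriv x)).add
      ((h.hasDerivAt x).div_const 2)).congr_deriv ?_
    linear_combination 2 * h.ode x
  have hq : HasDerivAt (fun x => x * (2 * N - x) + d + 1 / 4) (2 * N - 2 * x) x :=
    ((((hasDerivAt_id' x).mul ((hasDerivAt_id' x).const_sub (2 * N))).add_const _).add_const
      _).congr_deriv (by ring)
  exact ((hp.pow 2).add (hq.mul (h.hasDerivAt_sq x))).congr_deriv (by push_cast; ring)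

theorem antitoneOn_soninEnergy_div_sqrt (h : IsLaguerreSolution d N u) :
    AntitoneOn (fun x => soninEnergy d N u x / √x) (Set.Ioi 0) := by
  have hderiv : ∀ x ∈ Set.Ioi (0 : ℝ), HasDerivAt (fun x => soninEnergy d N u x / √x)
      (-(8 * d * (x * deriv u x) ^ 2 + (x ^ 2 + d / 2 + 1 / 4) * u x ^ 2) / (x * √x)) x := by
    intro x (hx : 0 < x)
    have hs : 0 < √x := Real.sqrt_pos.2 hx
    refine ((h.hasDerivAt_soninEnergy x).div (Real.hasDerivAt_sqrt hx.ne') hs.ne').congr_deriv ?_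
    rw [soninEnergy]
    field_simp
    rw [Real.sq_sqrt hx.le]
    ring
  refine antitoneOn_of_hasDerivWithinAt_nonpos (convex_Ioi 0)
    (fun x hx => (hderiv x hx).continuousAt.continuousWithinAt)
    (fun x hx => (hderiv x (interior_subset hx)).hasDerivWithinAt) fun x hx => ?_
  have hx : 0 < x := interior_subset hx
  exact div_nonpos_of_nonpos_of_nonneg (neg_nonpos.2 (by positivity)) (by positivity)

theorem soninEnergy_inv_le (h : IsLaguerreSolution d N u) : soninEnergy d N u N⁻¹ ≤ 2 * d + 9 := by
  have hN := h.pos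
  have hinv : N⁻¹ * N = 1 := inv_mul_cancel₀ hN.ne'
  have hpos : 0 < N⁻¹ := inv_pos.2 hN
  have hu : u N⁻¹ ^ 2 ≤ 2 := h.sq_le_two hpos.le h.inv_le
  have hderiv : (2 * N⁻¹ * deriv u N⁻¹) ^ 2 ≤ 2 := by
    have hpotential : 0 ≤ (N / 2 - N⁻¹ / 4) * u N⁻¹ ^ 2 :=
      mul_nonneg (by linarith [h.inv_le]) (sq_nonneg _)
    have henergy := h.laguerreEnergy_le hpos.le
    rw [laguerreEnergy] at henergy
    calc (2 * N⁻¹ * deriv u N⁻¹) ^ 2 = 4 * N⁻¹ * (N⁻¹ * deriv u N⁻¹ ^ 2) := by ring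
      _ ≤ 4 * N⁻¹ * (N / 2) := by gcongr; linarith
      _ = 2 := by linear_combination 2 * hinv
  have hpotential : (N⁻¹ * (2 * N - N⁻¹) + d + 1 / 4) * u N⁻¹ ^ 2 ≤ (2 + d + 1 / 4) * 2 := by
    gcongr
    nlinarith
  rw [soninEnergy]
  linarith [sq_nonneg (u N⁻¹ - 2 * N⁻¹ * deriv u N⁻¹)]

theorem soninEnergy_le_mul_sqrt (h : IsLaguerreSolution d N u) (hx : N⁻¹ ≤ x) :
    soninEnergy d N u x ≤ (2 * d + 9) * √(x * N) := by
  have hinv : 0 < N⁻¹ := inv_pos.2 h.pos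
  have hx0 : 0 < x := hinv.trans_le hx
  have hmono := h.antitoneOn_soninEnergy_div_sqrt hinv hx0 hx
  simp only [Real.sqrt_inv, div_inv_eq_mul] at hmono
  calc soninEnergy d N u x ≤ soninEnergy d N u N⁻¹ * √N * √x :=
        (div_le_iff₀ (Real.sqrt_pos.2 hx0)).1 hmono
    _ ≤ (2 * d + 9) * √N * √x := by gcongr; exact h.soninEnergy_inv_le
    _ = (2 * d + 9) * √(x * N) := by rw [Real.sqrt_mul hx0.le]; ring

theorem pow_four_mul_le (h : IsLaguerreSolution d N u) (hx : N⁻¹ ≤ x) (hxN : x ≤ N) :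
    u x ^ 4 * (x * N) ≤ (2 * d + 9) ^ 2 := by
  have hN := h.pos
  have hx0 : 0 < x := (inv_pos.2 hN).trans_le hx
  have hsq : √(x * N) ^ 2 = x * N := Real.sq_sqrt (by positivity)
  have hsqrt : u x ^ 2 * √(x * N) ≤ 2 * d + 9 := by
    refine le_of_mul_le_mul_right ?_ (Real.sqrt_pos.2 (mul_pos hx0 hN))
    calc u x ^ 2 * √(x * N) * √(x * N) = x * N * u x ^ 2 := by linear_combination u x ^ 2 * hsq
      _ ≤ x * (2 * N - x) * u x ^ 2 := by gcongr; linarith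
      _ ≤ (2 * d + 9) * √(x * N) :=
        (mul_sq_le_soninEnergy d N u x).trans (h.soninEnergy_le_mul_sqrt hx)
  calc u x ^ 4 * (x * N) = (u x ^ 2 * √(x * N)) ^ 2 := by rw [mul_pow, hsq]; ring
    _ ≤ (2 * d + 9 : ℝ) ^ 2 := by gcongr

theorem soninEnergy_le_mul (h : IsLaguerreSolution d N u) (hx : N ≤ x) :
    soninEnergy d N u x ≤ (2 * d + 9) * x := by
  have hx0 : 0 ≤ x := h.pos.le.trans hx
  calc soninEnergy d N u x ≤ (2 * d + 9) * √(x * N) := h.soninEnergy_le_mul_sqrt (h.inv_le.trans hx)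
    _ ≤ (2 * d + 9) * √(x * x) := by gcongr
    _ = (2 * d + 9) * x := by rw [Real.sqrt_mul_self hx0]

theorem sub_mul_sq_le (h : IsLaguerreSolution d N u) (hx : N ≤ x) :
    (2 * N - x) * u x ^ 2 ≤ 2 * d + 9 := by
  refine le_of_mul_le_mul_left ?_ (h.pos.trans_le hx)
  linarith [(mul_sq_le_soninEnergy d N u x).trans (h.soninEnergy_le_mul hx)]

theorem mul_deriv_sq_le (h : IsLaguerreSolution d N u) (hx : N ≤ x) (hxN : x ≤ 2 * N) :
    2 * N * deriv u x ^ 2 ≤ 2 * d + 9 := by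
  have hx0 : 0 < x := h.pos.trans_le hx
  refine le_of_mul_le_mul_left ?_ hx0
  calc x * (2 * N * deriv u x ^ 2) ≤ x * (2 * x * deriv u x ^ 2) := by gcongr
    _ = 2 * (x * deriv u x) ^ 2 := by ring
    _ ≤ x * (2 * d + 9) := by
      linarith [(sq_mul_deriv_le_soninEnergy d u hx0.le hxN).trans (h.soninEnergy_le_mul hx)]

theorem mul_sub_sq_le (h : IsLaguerreSolution d N u) {y : ℝ} (hy : N ≤ y) (hyx : y ≤ x)
    (hx : x ≤ 2 * N) : 2 * N * (u x - u y) ^ 2 ≤ (2 * d + 9) * (x - y) ^ 2 := by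
  have hN := h.pos
  have hderiv : ∀ t ∈ Set.Icc N (2 * N), ‖deriv u t‖ ≤ √((2 * d + 9) / (2 * N)) := fun t ht =>
    Real.abs_le_sqrt ((le_div_iff₀' (by positivity)).2 (h.mul_deriv_sq_le ht.1 ht.2))
  have hlip : |u x - u y| ≤ √((2 * d + 9) / (2 * N)) * |x - y| :=
    (convex_Icc N (2 * N)).norm_image_sub_le_of_norm_deriv_le (fun t _ => h.differentiable t)
      hderiv ⟨hy, hyx.trans hx⟩ ⟨hy.trans hyx, hx⟩
  calc 2 * N * (u x - u y) ^ 2 ≤ 2 * N * (√((2 * d + 9) / (2 * N)) * |x - y|) ^ 2 := by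
        rw [← sq_abs (u x - u y)]; gcongr
    _ = (2 * d + 9) * (x - y) ^ 2 := by
        rw [mul_pow, Real.sq_sqrt (by positivity), sq_abs]; field_simp

/-- Near the turning point `2 * N` the factor `2 * N - x` of `sub_mul_sq_le` degenerates; there one
compares with the value at `2 * N - l`, and `l = N ^ (1 / 3)` balances the two errors. -/
theorem sq_mul_le_of_le_two_mul (h : IsLaguerreSolution d N u) {l : ℝ} (hl : 1 ≤ l)
    (hlN : l ^ 3 = N) (hx : N ≤ x) (hxN : x ≤ 2 * N) : u x ^ 2 * l ≤ 3 * (2 * d + 9) := by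
  have hl_le : l ≤ N := hlN ▸ le_self_pow₀ hl (by norm_num)
  have hleft : ∀ {y}, N ≤ y → y ≤ 2 * N - l → u y ^ 2 * l ≤ 2 * d + 9 := fun {y} hy hyl => by
    refine le_trans ?_ (h.sub_mul_sq_le hy)
    rw [mul_comm]
    gcongr
    linarith
  rcases le_total x (2 * N - l) with hxl | hxl
  · linarith [hleft hx hxl, show (0 : ℝ) ≤ d by positivity]
  · have hy := hleft (show N ≤ 2 * N - l by linarith) le_rfl
    have hdiff : (u x - u (2 * N - l)) ^ 2 * l ≤ (2 * d + 9) / 2 := by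
      have hxy := h.mul_sub_sq_le (by linarith) hxl hxN
      refine le_of_mul_le_mul_left ?_ (show 0 < 2 * l ^ 2 by positivity)
      calc 2 * l ^ 2 * ((u x - u (2 * N - l)) ^ 2 * l)
          = 2 * N * (u x - u (2 * N - l)) ^ 2 := by rw [← hlN]; ring
        _ ≤ (2 * d + 9) * (x - (2 * N - l)) ^ 2 := hxy
        _ ≤ (2 * d + 9) * l ^ 2 := by
          have : 0 ≤ x - (2 * N - l) := sub_nonneg.2 hxl
          gcongr
          linarith
        _ = 2 * l ^ 2 * ((2 * d + 9) / 2) := by ring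
    have hsq : u x ^ 2 ≤ 2 * u (2 * N - l) ^ 2 + 2 * (u x - u (2 * N - l)) ^ 2 := by
      linarith [sq_nonneg (u x - 2 * u (2 * N - l))]
    calc u x ^ 2 * l ≤ (2 * u (2 * N - l) ^ 2 + 2 * (u x - u (2 * N - l)) ^ 2) * l := by gcongr
      _ ≤ 3 * (2 * d + 9 : ℝ) := by linarith

theorem mul_deriv_nonpos (h : IsLaguerreSolution d N u) (hx : 2 * N ≤ x) :
    u x * deriv u x ≤ 0 := by
  have hN := h.pos
  have hderiv : ∀ x, HasDerivAt (fun x => x ^ (d + 1) * (u x * deriv u x))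
      (x ^ d * (x * deriv u x ^ 2 + (x / 4 - N / 2) * u x ^ 2)) x := fun x => by
    refine ((hasDerivAt_pow (d + 1) x).mul
      ((h.hasDerivAt x).mul (h.hasDerivAt_deriv x))).congr_deriv ?_
    simp only [Nat.add_sub_cancel, Pi.mul_apply]
    push_cast
    linear_combination x ^ d * u x * h.ode x
  have hmono : MonotoneOn (fun x => x ^ (d + 1) * (u x * deriv u x)) (Set.Ici (2 * N)) := by
    refine monotoneOn_of_hasDerivWithinAt_nonneg (convex_Ici _)
      (fun x _ => (hderiv x).continuousAt.continuousWithinAt)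
      (fun x _ => (hderiv x).hasDerivWithinAt) fun x hx => ?_
    have hx : 2 * N ≤ x := interior_subset hx
    have hx0 : 0 ≤ x := by linarith
    have hcoeff : 0 ≤ x / 4 - N / 2 := by linarith
    positivity
  have hlim : Tendsto (fun x => x ^ (d + 1) * (u x * deriv u x)) atTop (𝓝 0) := by
    simpa [mul_assoc] using (h.tendsto_pow_mul (d + 1)).mul (h.tendsto_pow_mul_deriv 0)
  have hle : x ^ (d + 1) * (u x * deriv u x) ≤ 0 := by
    refine ge_of_tendsto hlim ?_
    filter_upwards [eventually_ge_atTop x] with y hy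
    exact hmono hx (hx.trans hy) hy
  have hx0 : 0 < x := by linarith
  exact nonpos_of_mul_nonpos_right hle (by positivity)

theorem antitoneOn_sq (h : IsLaguerreSolution d N u) :
    AntitoneOn (fun x => u x ^ 2) (Set.Ici (2 * N)) :=
  antitoneOn_of_hasDerivWithinAt_nonpos (convex_Ici _)
    (fun x _ => (h.hasDerivAt_sq x).continuousAt.continuousWithinAt)
    (fun x _ => (h.hasDerivAt_sq x).hasDerivWithinAt)
    fun _ hx => mul_nonpos_of_nonneg_of_nonpos zero_le_two (h.mul_deriv_nonpos (interior_subset hx))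

theorem sq_le_neg_mul_deriv (h : IsLaguerreSolution d N u) (hx : 3 * N ≤ x) :
    u x ^ 2 ≤ -(u x * (2 * x * deriv u x)) := by
  have hN := h.one_le
  have hx0 : 0 ≤ x := by linarith
  have hsq : u x ^ 2 ≤ (2 * x * deriv u x) ^ 2 := by
    have henergy := h.laguerreEnergy_nonneg x
    rw [laguerreEnergy] at henergy
    calc u x ^ 2 ≤ x * (x - 2 * N) * u x ^ 2 :=
          le_mul_of_one_le_left (sq_nonneg _) (by nlinarith)
      _ ≤ (2 * x * deriv u x) ^ 2 := by nlinarith [mul_nonneg hx0 henergy]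
  have hsign : u x * (2 * x * deriv u x) ≤ 0 := by
    have := mul_nonpos_of_nonneg_of_nonpos hx0 (h.mul_deriv_nonpos (x := x) (by linarith))
    linarith
  calc u x ^ 2 = |u x| * |u x| := by rw [abs_mul_abs_self, sq]
    _ ≤ |u x| * |2 * x * deriv u x| := by gcongr |u x| * ?_; exact sq_le_sq.1 hsq
    _ = -(u x * (2 * x * deriv u x)) := by rw [← abs_mul, abs_of_nonpos hsign]

theorem antitoneOn_mul_sq (h : IsLaguerreSolution d N u) :
    AntitoneOn (fun x => x * u x ^ 2) (Set.Ici (3 * N)) := by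
  have hderiv : ∀ x, HasDerivAt (fun x => x * u x ^ 2) (u x ^ 2 + u x * (2 * x * deriv u x)) x :=
    fun x => ((hasDerivAt_id' x).mul (h.hasDerivAt_sq x)).congr_deriv (by ring)
  refine antitoneOn_of_hasDerivWithinAt_nonpos (convex_Ici _)
    (fun x _ => (hderiv x).continuousAt.continuousWithinAt)
    (fun x _ => (hderiv x).hasDerivWithinAt) fun x hx => ?_
  linarith [h.sq_le_neg_mul_deriv (interior_subset hx)]

theorem pow_six_mul_le (h : IsLaguerreSolution d N u) (hx : N ≤ x) :
    u x ^ 6 * N ≤ 27 * (2 * d + 9) ^ 3 := by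
  have hlN : (N ^ (3⁻¹ : ℝ)) ^ 3 = N := Real.rpow_inv_natCast_pow h.pos.le three_ne_zero
  have hl : 1 ≤ N ^ (3⁻¹ : ℝ) := Real.one_le_rpow h.one_le (by norm_num)
  have hsq : u x ^ 2 * N ^ (3⁻¹ : ℝ) ≤ 3 * (2 * d + 9) := by
    rcases le_total x (2 * N) with hxN | hxN
    · exact h.sq_mul_le_of_le_two_mul hl hlN hx hxN
    · refine le_trans ?_ (h.sq_mul_le_of_le_two_mul hl hlN (by linarith [h.pos]) le_rfl)
      exact mul_le_mul_of_nonneg_right (h.antitoneOn_sq Set.self_mem_Ici hxN hxN) (by positivity)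
  calc u x ^ 6 * N = (u x ^ 2 * N ^ (3⁻¹ : ℝ)) ^ 3 := by rw [mul_pow, hlN]; ring
    _ ≤ (3 * (2 * d + 9) : ℝ) ^ 3 := by gcongr
    _ = 27 * (2 * d + 9 : ℝ) ^ 3 := by ring

theorem pow_six_mul_self_le (h : IsLaguerreSolution d N u) (hx : N ≤ x) :
    u x ^ 6 * x ≤ 81 * (2 * d + 9) ^ 3 := by
  have hN := h.pos
  rcases le_total x (3 * N) with hxN | hxN
  · calc u x ^ 6 * x ≤ u x ^ 6 * (3 * N) := by gcongr
      _ ≤ 81 * (2 * d + 9 : ℝ) ^ 3 := by linarith [h.pow_six_mul_le hx]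
  · have hx0 : 0 < x := hN.trans_le hx
    have hthird := h.pow_six_mul_le (x := 3 * N) (by linarith)
    have hanti : x * u x ^ 2 ≤ 3 * N * u (3 * N) ^ 2 :=
      h.antitoneOn_mul_sq Set.self_mem_Ici hxN hxN
    refine le_of_mul_le_mul_left ?_ (show 0 < x ^ 2 by positivity)
    calc x ^ 2 * (u x ^ 6 * x) = (x * u x ^ 2) ^ 3 := by ring
      _ ≤ (3 * N * u (3 * N) ^ 2) ^ 3 := by gcongr
      _ = (3 * N) ^ 2 * (3 * (u (3 * N) ^ 6 * N)) := by ring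
      _ ≤ x ^ 2 * (3 * (27 * (2 * d + 9) ^ 3)) := by gcongr
      _ = x ^ 2 * (81 * (2 * d + 9) ^ 3) := by ring

theorem pow_twelve_mul_le (h : IsLaguerreSolution d N u) (hx : 0 ≤ x) :
    u x ^ 12 * (1 + N * x) ≤ 2 * (81 * (2 * d + 9) ^ 3) ^ 2 := by
  have hN := h.one_le
  rcases le_total x N with hxN | hxN
  · have hsq := h.sq_le_two hx hxN
    have hd : (1 : ℝ) ≤ 2 * d + 9 := by linarith [d.cast_nonneg (α := ℝ)]
    have hconst : (64 : ℝ) * (2 * d + 9) ^ 2 ≤ (81 * (2 * d + 9) ^ 3) ^ 2 := by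
      calc (64 : ℝ) * (2 * d + 9) ^ 2 ≤ 81 ^ 2 * (2 * d + 9) ^ 6 :=
            mul_le_mul (by norm_num) (pow_le_pow_right₀ hd (by norm_num)) (by positivity)
              (by norm_num)
        _ = _ := by ring
    rcases le_total x N⁻¹ with hxN' | hxN'
    · have hNx : N * x ≤ 1 := (le_inv_mul_iff₀ h.pos).1 (by simpa using hxN')
      calc u x ^ 12 * (1 + N * x) = (u x ^ 2) ^ 6 * (1 + N * x) := by ring
        _ ≤ 2 ^ 6 * (1 + 1) := by gcongr
        _ ≤ 2 * (81 * (2 * d + 9 : ℝ) ^ 3) ^ 2 := by nlinarith only [hconst, hd]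
    · have hNx : 1 ≤ N * x := (inv_le_iff_one_le_mul₀' h.pos).1 hxN'
      calc u x ^ 12 * (1 + N * x) ≤ u x ^ 12 * (2 * (N * x)) := by gcongr; linarith
        _ = 2 * ((u x ^ 2) ^ 4 * (u x ^ 4 * (x * N))) := by ring
        _ ≤ 2 * (2 ^ 4 * (2 * d + 9 : ℝ) ^ 2) := by gcongr; exact h.pow_four_mul_le hxN' hxN
        _ ≤ 2 * (81 * (2 * d + 9 : ℝ) ^ 3) ^ 2 := by
          linarith only [hconst, sq_nonneg (2 * d + 9 : ℝ)]
  · have hx1 : 1 ≤ x := hN.trans hxN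
    calc u x ^ 12 * (1 + N * x) ≤ u x ^ 12 * (x * x + x * x) := by gcongr; nlinarith
      _ = 2 * (u x ^ 6 * x) ^ 2 := by ring
      _ ≤ 2 * (81 * (2 * d + 9 : ℝ) ^ 3) ^ 2 := by
        gcongr 2 * ?_ ^ 2; exact h.pow_six_mul_self_le hxN

theorem abs_le (h : IsLaguerreSolution d N u) (hx : 0 ≤ x) :
    |u x| ≤ 2 * (81 * (2 * d + 9) ^ 3) ^ 2 * (1 + N * x) ^ (-12⁻¹ : ℝ) := by
  have hN := h.pos
  have hpos : 0 < 1 + N * x := by positivity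
  have hC : 1 ≤ 2 * (81 * (2 * d + 9 : ℝ) ^ 3) ^ 2 := by
    have : 1 ≤ 81 * (2 * d + 9 : ℝ) ^ 3 := by
      refine one_le_mul_of_one_le_of_one_le (by norm_num) (one_le_pow₀ ?_)
      linarith [show (0 : ℝ) ≤ d by positivity]
    linarith [one_le_pow₀ (n := 2) this]
  set C : ℝ := 2 * (81 * (2 * d + 9) ^ 3) ^ 2
  have hroot : ((1 + N * x) ^ (12⁻¹ : ℝ)) ^ 12 = 1 + N * x :=
    Real.rpow_inv_natCast_pow hpos.le (by norm_num)
  rw [Real.rpow_neg hpos.le, ← div_eq_mul_inv, le_div_iff₀ (Real.rpow_pos_of_pos hpos _)]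
  refine le_of_pow_le_pow_left₀ (n := 12) (by norm_num) (by positivity) ?_
  calc (|u x| * (1 + N * x) ^ (12⁻¹ : ℝ)) ^ 12 = u x ^ 12 * (1 + N * x) := by
        rw [mul_pow, hroot, Even.pow_abs (by decide)]
    _ ≤ C := h.pow_twelve_mul_le hx
    _ ≤ C ^ 12 := le_self_pow₀ hC (by norm_num)

end IsLaguerreSolution

/-! ### Normalised Laguerre functions -/

section NormalisedLaguerre

open Polynomial

/-- The coefficients `(-1)^j d! / (j! (d + j)!)` in the power series of
`d! (2 / s)^d J_d(s) = ∑ j, besselCoeff d j * (s² / 4)^j`. -/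
def besselCoeff (d j : ℕ) : ℝ := (-1) ^ j * d ! / (j ! * (d + j)!)

theorem besselCoeff_zero (d : ℕ) : besselCoeff d 0 = 1 := by
  simp [besselCoeff, Nat.factorial_ne_zero]

theorem besselCoeff_succ (d j : ℕ) :
    besselCoeff d (j + 1) * ((j + 1) * (d + j + 1)) = -besselCoeff d j := by
  rw [besselCoeff, besselCoeff, ← add_assoc, Nat.factorial_succ, Nat.factorial_succ]
  push_cast
  field_simp
  ring

theorem abs_besselCoeff_le (d j : ℕ) : |besselCoeff d j| ≤ 1 / j ! := by
  have hfactorial : (d ! : ℝ) ≤ (d + j)! := mod_cast Nat.factorial_le (Nat.le_add_right d j)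
  rw [besselCoeff, abs_div, abs_mul, abs_neg_one_pow, one_mul, Nat.abs_cast,
    abs_of_pos (by positivity), div_le_div_iff₀ (by positivity) (by positivity), one_mul, mul_comm]
  gcongr

theorem cast_descFactorial_succ {R : Type*} [Ring R] (k m : ℕ) :
    (k.descFactorial (m + 1) : R) = k.descFactorial m * (k - m) := by
  simp only [← descPochhammer_eval_eq_descFactorial, descPochhammer_succ_eval]

/-- The Laguerre polynomial `L_k^d` divided by its value at `0`. -/
def normLaguerrePoly (d k : ℕ) : ℝ[X] :=
  ∑ j ∈ Finset.range (k + 1), monomial j (besselCoeff d j * k.descFactorial j)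

theorem coeff_normLaguerrePoly (d k m : ℕ) :
    (normLaguerrePoly d k).coeff m = besselCoeff d m * k.descFactorial m := by
  simp only [normLaguerrePoly, finsetSum_coeff, coeff_monomial, Finset.sum_ite_eq',
    Finset.mem_range, ite_eq_left_iff]
  intro hm
  simp [Nat.descFactorial_of_lt (show k < m by lia)]

theorem eval_normLaguerrePoly (d k : ℕ) (x : ℝ) :
    (normLaguerrePoly d k).eval x = k ! * d ! / (k + d)! * laguerreL d k x := by
  rw [laguerreL, normLaguerrePoly, eval_finsetSum, Finset.mul_sum]
  refine Finset.sum_congr rfl fun j hj => ?_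
  have hjk : j ≤ k := Finset.mem_range_succ_iff.1 hj
  have hchoose : ((k + d).choose (k - j) * (k - j)! * (d + j)! : ℝ) = (k + d)! := by
    have := Nat.choose_mul_factorial_mul_factorial (show k - j ≤ k + d by lia)
    rw [show k + d - (k - j) = d + j by lia] at this
    exact_mod_cast this
  have hdesc : ((k - j)! * k.descFactorial j : ℝ) = k ! :=
    mod_cast Nat.factorial_mul_descFactorial hjk
  have hchoose_ne : ((k + d).choose (k - j) : ℝ) ≠ 0 :=
    mod_cast (Nat.choose_pos (show k - j ≤ k + d by lia)).ne'
  rw [eval_monomial, besselCoeff, ← hchoose, ← hdesc]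
  field_simp

theorem normLaguerrePoly_ode (d k : ℕ) :
    X * derivative (derivative (normLaguerrePoly d k))
      + (((d + 1 : ℕ) : ℝ[X]) - X) * derivative (normLaguerrePoly d k)
      + (k : ℝ[X]) * normLaguerrePoly d k = 0 := by
  ext m
  rw [sub_mul, coeff_add, coeff_add, coeff_sub, coeff_natCast_mul, coeff_natCast_mul, coeff_zero]
  rcases m with _ | m
  · have hcoeff := besselCoeff_succ d 0
    simp only [mul_coeff_zero, coeff_X_zero, coeff_derivative, coeff_normLaguerrePoly,
      cast_descFactorial_succ]
    push_cast at hcoeff ⊢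
    linear_combination (k * k.descFactorial 0 : ℝ) * hcoeff
  · have hcoeff := besselCoeff_succ d (m + 1)
    simp only [coeff_X_mul, coeff_derivative, coeff_normLaguerrePoly,
      cast_descFactorial_succ k (m + 1)]
    push_cast at hcoeff ⊢
    linear_combination ((k - (m + 1)) * k.descFactorial (m + 1) : ℝ) * hcoeff

theorem hasDerivAt_eval_mul_exp (p : ℝ[X]) (x : ℝ) :
    HasDerivAt (fun x => p.eval x * Real.exp (-(x / 2)))
      ((derivative p - C (1 / 2) * p).eval x * Real.exp (-(x / 2))) x := by
  refine ((p.hasDerivAt x).mul ((((hasDerivAt_id' x).div_const 2).fun_neg).exp)).congr_deriv ?_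
  simp only [eval_sub, eval_mul, eval_C]
  ring

theorem deriv_eval_mul_exp (p : ℝ[X]) :
    deriv (fun x => p.eval x * Real.exp (-(x / 2))) =
      fun x => (derivative p - C (1 / 2) * p).eval x * Real.exp (-(x / 2)) :=
  deriv_eq (hasDerivAt_eval_mul_exp p)

theorem tendsto_pow_mul_eval_mul_exp (p : ℝ[X]) (m : ℕ) :
    Tendsto (fun x => x ^ m * (p.eval x * Real.exp (-(x / 2)))) atTop (𝓝 0) := by
  have hlim := (tendsto_div_exp_atTop ((X ^ m * p).comp (C 2 * X))).comp
    (tendsto_id.atTop_div_const two_pos)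
  refine hlim.congr fun x => ?_
  simp only [Function.comp_apply, id_eq, eval_comp, eval_mul, eval_pow, eval_C, eval_X,
    mul_div_cancel₀ x two_ne_zero, Real.exp_neg]
  ring

/-- The normalised Laguerre function `e^{-x/2} L_k^d(x) / L_k^d(0)`. -/
def normLaguerreFun (d k : ℕ) (x : ℝ) : ℝ :=
  (normLaguerrePoly d k).eval x * Real.exp (-(x / 2))

theorem isLaguerreSolution_normLaguerreFun (d k : ℕ) :
    IsLaguerreSolution d (2 * k + d + 1) (normLaguerreFun d k) := by
  have hdiff : ∀ p : ℝ[X], Differentiable ℝ fun x => p.eval x * Real.exp (-(x / 2)) :=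
    fun p x => (hasDerivAt_eval_mul_exp p x).differentiableAt
  have hderiv := deriv_eval_mul_exp (normLaguerrePoly d k)
  refine ⟨?_, hdiff _, ?_, fun x => ?_, ?_, tendsto_pow_mul_eval_mul_exp _, fun m => ?_⟩
  · linarith [k.cast_nonneg (α := ℝ), d.cast_nonneg (α := ℝ)]
  · exact hderiv ▸ hdiff _
  · have hode := congrArg (eval x) (normLaguerrePoly_ode d k)
    simp only [eval_add, eval_mul, eval_sub, eval_X, eval_natCast, eval_zero] at hode
    unfold normLaguerreFun
    rw [hderiv, deriv_eval_mul_exp]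
    simp only [eval_mul, eval_sub, eval_C, derivative_sub,
      derivative_C_mul]
    push_cast at hode
    linear_combination Real.exp (-(x / 2)) * hode
  · simp [normLaguerreFun, ← coeff_zero_eq_eval_zero, coeff_normLaguerrePoly, besselCoeff_zero]
  · unfold normLaguerreFun
    exact hderiv ▸ tendsto_pow_mul_eval_mul_exp _ m

theorem exists_abs_normLaguerreFun_le (d : ℕ) : ∃ C : ℝ, ∀ (k : ℕ) (x : ℝ), 0 ≤ x →
    |normLaguerreFun d k x| ≤ C * (1 + (2 * k + d + 1) * x) ^ (-12⁻¹ : ℝ) :=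
  ⟨_, fun k _ hx => (isLaguerreSolution_normLaguerreFun d k).abs_le hx⟩

end NormalisedLaguerre

/-! ### The kernel interpolating between Laguerre and Bessel functions -/

theorem prod_range_mul_sub_mul {R : Type*} [CommRing R] (k j : ℕ) (x : R) :
    ∏ i ∈ Finset.range j, (k * x - i * x) = k.descFactorial j * x ^ j := by
  simp only [← sub_mul, Finset.prod_mul_distrib, Finset.prod_const, Finset.card_range,
    ← descPochhammer_eval_eq_descFactorial, descPochhammer_eval_eq_prod_range]

/-- The pairs `(x, y)` of nonnegative reals with `x = 0` or `y = k x` for some `k : ℕ`: the fan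
with its two halves folded together, in the coordinates `x = |λ|` and `y = (τ - n |λ|) / 2`. -/
def kernelRegion : Set (ℝ × ℝ) :=
  {p | 0 ≤ p.1 ∧ 0 ≤ p.2 ∧ (p.1 = 0 ∨ ∃ k : ℕ, p.2 = k * p.1)}

theorem abs_prod_range_sub_le {p : ℝ × ℝ} (hp : p ∈ kernelRegion) (j : ℕ) :
    |∏ i ∈ Finset.range j, (p.2 - i * p.1)| ≤ p.2 ^ j := by
  obtain ⟨hfst, hsnd, hzero | ⟨k, hk⟩⟩ := hp
  · simp [hzero, abs_of_nonneg hsnd]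
  · rw [hk, prod_range_mul_sub_mul, abs_of_nonneg (by positivity), mul_pow]
    gcongr
    exact_mod_cast Nat.descFactorial_le_pow k j

/-- The function interpolating between the normalised Laguerre functions of `x`, on the rays
`y = k x`, and the normalised Bessel function of `2 √y`, on the half-line `x = 0`. -/
def fanKernel (d : ℕ) (p : ℝ × ℝ) : ℝ :=
  Real.exp (-(p.1 / 2)) * ∑' j, besselCoeff d j * ∏ i ∈ Finset.range j, (p.2 - i * p.1)

theorem fanKernel_nat_mul (d k : ℕ) (x : ℝ) :
    fanKernel d (x, k * x) = normLaguerreFun d k x := by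
  simp only [fanKernel, normLaguerreFun, normLaguerrePoly, Polynomial.eval_finsetSum,
    prod_range_mul_sub_mul, Polynomial.eval_monomial]
  rw [tsum_eq_sum (s := Finset.range (k + 1)), mul_comm]
  · simp only [mul_assoc]
  · intro j hj
    simp [Nat.descFactorial_of_lt (show k < j by simpa using hj)]

theorem fanKernel_zero_left (d : ℕ) (s : ℝ) :
    fanKernel d (0, s ^ 2 / 4) = d ! * 2 ^ d * besselQuot d s := by
  simp only [fanKernel, zero_div, neg_zero, Real.exp_zero, one_mul, mul_zero, sub_zero,
    Finset.prod_const, Finset.card_range, besselQuot]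
  split_ifs with hs
  · rw [tsum_eq_single 0 fun j hj => by simp [hs, hj], besselCoeff_zero]
    field_simp
  · rw [besselJ, mul_div_assoc', ← tsum_mul_left, ← tsum_div_const]
    refine tsum_congr fun m => ?_
    rw [besselCoeff, pow_add, pow_mul, div_pow s 2 2, div_pow s 2 d, add_comm m d]
    norm_num
    field_simp

theorem continuousOn_fanKernel (d : ℕ) : ContinuousOn (fanKernel d) kernelRegion := by
  refine continuousOn_of_locally_continuousOn fun p _ => ⟨{q | q.2 < p.2 + 1},
    isOpen_lt continuous_snd continuous_const, lt_add_one p.2, ?_⟩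
  refine ContinuousOn.mul (by fun_prop) <| continuousOn_tsum
    (u := fun j => (p.2 + 1) ^ j / j !) (fun j => by fun_prop)
    (Real.summable_pow_div_factorial _) fun j q ⟨hq, (hqp : q.2 < p.2 + 1)⟩ => ?_
  have hq0 : 0 ≤ q.2 := hq.2.1
  calc ‖besselCoeff d j * ∏ i ∈ Finset.range j, (q.2 - i * q.1)‖
      ≤ 1 / j ! * q.2 ^ j := by
        rw [norm_mul]
        gcongr
        exacts [abs_besselCoeff_le d j, abs_prod_range_sub_le hq j]
    _ ≤ 1 / j ! * (p.2 + 1) ^ j := by gcongr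
    _ = (p.2 + 1) ^ j / j ! := one_div_mul_eq_div _ _

theorem tendsto_div_natCast_nhdsWithin_kernelRegion {y : ℝ} (hy : 0 ≤ y) :
    Tendsto (fun k : ℕ => (y / k, y)) atTop (𝓝[kernelRegion] (0, y)) := by
  refine tendsto_nhdsWithin_iff.2
    ⟨(tendsto_const_div_atTop_nhds_zero_nat y).prodMk_nhds tendsto_const_nhds, ?_⟩
  filter_upwards [eventually_ne_atTop 0] with k hk
  exact ⟨by positivity, hy, .inr ⟨k, (mul_div_cancel₀ y (Nat.cast_ne_zero.2 hk)).symm⟩⟩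

theorem exists_abs_fanKernel_le (d : ℕ) : ∃ C : ℝ, ∀ p ∈ kernelRegion,
    |fanKernel d p| ≤ C * (1 + (2 * p.2 + (d + 1) * p.1)) ^ (-12⁻¹ : ℝ) := by
  obtain ⟨C, hC⟩ := exists_abs_normLaguerreFun_le d
  have hray : ∀ (k : ℕ) (x : ℝ), 0 ≤ x → |fanKernel d (x, k * x)| ≤
      C * (1 + (2 * (k * x) + (d + 1) * x)) ^ (-12⁻¹ : ℝ) := fun k x hx => by
    rw [fanKernel_nat_mul, ← mul_assoc, ← add_mul, ← add_assoc]
    exact hC k x hx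
  refine ⟨C, ?_⟩
  rintro ⟨x, y⟩ ⟨hx : 0 ≤ x, hy : 0 ≤ y, (rfl : x = 0) | ⟨k, rfl : y = k * x⟩⟩
  · have hlim := tendsto_div_natCast_nhdsWithin_kernelRegion hy
    have hbound : ContinuousAt
        (fun p : ℝ × ℝ => C * (1 + (2 * p.2 + (d + 1) * p.1)) ^ (-12⁻¹ : ℝ)) (0, y) :=
      continuousAt_const.mul (ContinuousAt.rpow_const (by fun_prop)
        (.inl (show 1 + (2 * y + (d + 1) * 0) ≠ 0 by positivity)))
    refine le_of_tendsto_of_tendsto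
      ((continuousOn_fanKernel d (0, y) ⟨hx, hy, .inl rfl⟩).abs.tendsto.comp hlim)
      (hbound.tendsto.comp (tendsto_nhds_of_tendsto_nhdsWithin hlim)) ?_
    filter_upwards [eventually_ne_atTop 0] with k hk
    have := hray k (y / k) (by positivity)
    rwa [mul_div_cancel₀ y (Nat.cast_ne_zero.2 hk)] at this
  · exact hray k x hx

/-! ### The fan and its eigenfunctions -/

theorem mem_heisenbergFan_iff {n : ℕ} {a : EuclideanSpace ℝ (Fin 2)} (h0 : a 0 ≠ 0) :
    a ∈ heisenbergFan n ↔ (a 1 / |a 0| - n) / 2 ∈ Set.range ((↑) : ℕ → ℝ) := by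
  have habs : |a 0| ≠ 0 := abs_ne_zero.2 h0
  simp only [heisenbergFan, fanRay, fanLimitRay, Set.mem_union, Set.mem_iUnion, Set.mem_ofPred_eq,
    h0, false_and, or_false, Set.mem_range]
  refine exists_congr fun k => ?_
  rw [eq_div_iff two_ne_zero, eq_sub_iff_add_eq, eq_div_iff habs, mul_comm (k : ℝ), eq_comm]

theorem mul_abs_le_of_mem_heisenbergFan {n : ℕ} {a : EuclideanSpace ℝ (Fin 2)}
    (ha : a ∈ heisenbergFan n) : n * |a 0| ≤ a 1 := by
  rcases ha with ha | ⟨h0, h1⟩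
  · obtain ⟨k, hk : a 1 = (2 * k + n) * |a 0|⟩ := Set.mem_iUnion.1 ha
    rw [hk]
    gcongr
    exact le_add_of_nonneg_left (by positivity)
  · simpa [h0] using h1

theorem nonneg_of_mem_heisenbergFan {n : ℕ} {a : EuclideanSpace ℝ (Fin 2)}
    (ha : a ∈ heisenbergFan n) : 0 ≤ a 1 :=
  (by positivity : 0 ≤ n * |a 0|).trans (mul_abs_le_of_mem_heisenbergFan ha)

theorem isClosed_heisenbergFan (n : ℕ) : IsClosed (heisenbergFan n) := by
  refine isClosed_of_closure_subset fun a ha => ?_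
  by_cases h0 : a 0 = 0
  · have hclosed : IsClosed {b : EuclideanSpace ℝ (Fin 2) | 0 ≤ b 1} :=
      isClosed_le (by fun_prop) (by fun_prop)
    exact .inr ⟨h0, closure_minimal (fun _ => nonneg_of_mem_heisenbergFan) hclosed ha⟩
  · have hcont : ContinuousAt (fun b : EuclideanSpace ℝ (Fin 2) => (b 1 / |b 0| - n) / 2) a := by
      fun_prop (disch := exact abs_ne_zero.2 h0)
    have hne : ∀ᶠ b : EuclideanSpace ℝ (Fin 2) in 𝓝 a, b 0 ≠ 0 :=
      ContinuousAt.eventually_ne (g := fun b : EuclideanSpace ℝ (Fin 2) => b 0) (by fun_prop) h0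
    have hfreq := ((mem_closure_iff_frequently.1 ha).and_eventually hne).mono
      fun b hb => (mem_heisenbergFan_iff hb.2).1 hb.1
    exact (mem_heisenbergFan_iff h0).2
      (Nat.isClosedEmbedding_coe_real.isClosed_range.mem_of_frequently_of_tendsto hfreq hcont)

theorem cocompact_heisenbergFan_le (n : ℕ) : cocompact (heisenbergFan n) ≤
    comap (fun a : heisenbergFan n => ‖(a : EuclideanSpace ℝ (Fin 2))‖) atTop :=
  tendsto_iff_comap.1 <| (tendsto_norm_cocompact_atTop (E := EuclideanSpace ℝ (Fin 2))).comp
    (isClosed_heisenbergFan n).isClosedEmbedding_subtypeVal.tendsto_cocompact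

theorem norm_le_two_mul_of_mem_heisenbergFan {d : ℕ} {a : EuclideanSpace ℝ (Fin 2)}
    (ha : a ∈ heisenbergFan (d + 1)) : ‖a‖ ≤ 2 * a 1 := by
  have hτ : 0 ≤ a 1 := nonneg_of_mem_heisenbergFan ha
  have hlam : |a 0| ≤ a 1 :=
    (le_mul_of_one_le_left (abs_nonneg _) (by simp)).trans (mul_abs_le_of_mem_heisenbergFan ha)
  refine abs_le_of_sq_le_sq' ?_ (by positivity) |>.2
  rw [EuclideanSpace.real_norm_sq_eq, Fin.sum_univ_two]
  nlinarith [sq_abs (a 0), abs_nonneg (a 0)]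

theorem tendsto_apply_one_heisenbergFan (d : ℕ) :
    Tendsto (fun a : heisenbergFan (d + 1) => (a : EuclideanSpace ℝ (Fin 2)) 1)
      (comap (fun a : heisenbergFan (d + 1) => ‖(a : EuclideanSpace ℝ (Fin 2))‖) atTop) atTop :=
  tendsto_atTop_mono (fun a => (div_le_iff₀' two_pos).2 (norm_le_two_mul_of_mem_heisenbergFan a.2))
    (tendsto_comap.atTop_div_const two_pos)

/-- The point of `kernelRegion` at which `fanKernel d` gives the value on the sphere of radius `r`
of the eigenfunction attached to `a`. -/
def fanPoint (d : ℕ) (r : ℝ) (a : EuclideanSpace ℝ (Fin 2)) : ℝ × ℝ :=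
  (|a 0| * r ^ 2 / 2, (a 1 - (d + 1) * |a 0|) * r ^ 2 / 4)

theorem fanPoint_mem_kernelRegion {d : ℕ} (r : ℝ) {a : EuclideanSpace ℝ (Fin 2)}
    (ha : a ∈ heisenbergFan (d + 1)) : fanPoint d r a ∈ kernelRegion := by
  have hsub : 0 ≤ a 1 - (d + 1) * |a 0| :=
    sub_nonneg.2 (by simpa using mul_abs_le_of_mem_heisenbergFan ha)
  refine ⟨?_, ?_, ?_⟩
  · dsimp only [fanPoint]; positivity
  · dsimp only [fanPoint]; positivity
  · rcases ha with ha | ⟨h0, -⟩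
    · obtain ⟨k, hk : a 1 = (2 * k + (d + 1 : ℕ)) * |a 0|⟩ := Set.mem_iUnion.1 ha
      refine .inr ⟨k, ?_⟩
      simp only [fanPoint, hk]
      push_cast
      ring
    · exact .inl (by simp [fanPoint, h0])

theorem two_mul_snd_fanPoint_add (d : ℕ) (r : ℝ) (a : EuclideanSpace ℝ (Fin 2)) :
    2 * (fanPoint d r a).2 + (d + 1) * (fanPoint d r a).1 = a 1 * (r ^ 2 / 2) := by
  simp only [fanPoint]
  ring

/-- The factor by which the normalised Strichartz Fourier transform at `a` differs from the
Strichartz Fourier transform. -/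
def fanNormConst (n : ℕ) (a : EuclideanSpace ℝ (Fin 2)) : ℂ :=
  if a 0 = 0 then 1
  else (((fanIndex n a)! * (n - 1)! / (fanIndex n a + n - 1)! : ℝ) : ℂ)

theorem fanNormConst_ne_zero (n : ℕ) (a : EuclideanSpace ℝ (Fin 2)) : fanNormConst n a ≠ 0 := by
  rw [fanNormConst]
  split_ifs
  · exact one_ne_zero
  · exact Complex.ofReal_ne_zero.2 (by positivity)

/-- The eigenfunction `e_a` divided by its value at the identity. -/
def normFanEigen (n : ℕ) (a : EuclideanSpace ℝ (Fin 2)) (g : Heisenberg n) : ℂ :=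
  fanNormConst n a * fanEigen n a g

theorem normFanEigen_of_eq_zero {d : ℕ} {a : EuclideanSpace ℝ (Fin 2)} (h0 : a 0 = 0)
    (h1 : 0 ≤ a 1) (g : Heisenberg (d + 1)) :
    normFanEigen (d + 1) a g = fanKernel d (fanPoint d ‖g.1‖ a) := by
  have hpoint : fanPoint d ‖g.1‖ a = (0, (√(a 1) * ‖g.1‖) ^ 2 / 4) := by
    simp [fanPoint, h0, mul_pow, Real.sq_sqrt h1]
  rw [hpoint, fanKernel_zero_left, normFanEigen, fanNormConst, if_pos h0, fanEigen, if_pos h0,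
    besselEigen, Nat.add_sub_cancel, one_mul]

theorem normFanEigen_of_mem_fanRay {d k : ℕ} {a : EuclideanSpace ℝ (Fin 2)} (h0 : a 0 ≠ 0)
    (ha : a ∈ fanRay (d + 1) k) (g : Heisenberg (d + 1)) :
    normFanEigen (d + 1) a g =
      Complex.exp (Complex.I * a 0 * g.2) * fanKernel d (fanPoint d ‖g.1‖ a) := by
  have hpoint : fanPoint d ‖g.1‖ a =
      (1 / 2 * |a 0| * ‖g.1‖ ^ 2, k * (1 / 2 * |a 0| * ‖g.1‖ ^ 2)) := by
    rw [fanPoint, show a 1 = (2 * k + (d + 1 : ℕ)) * |a 0| from ha]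
    push_cast
    ext <;> dsimp only <;> ring
  have hexp : -(1 / 4) * |a 0| * ‖g.1‖ ^ 2 = -(1 / 2 * |a 0| * ‖g.1‖ ^ 2 / 2) := by ring
  rw [hpoint, fanKernel_nat_mul, normLaguerreFun, eval_normLaguerrePoly, normFanEigen,
    fanNormConst, if_neg h0, fanEigen, if_neg h0, fanIndex_eq ha h0, laguerreEigen, laguerreFun,
    hexp, Nat.add_sub_cancel, ← Nat.add_assoc, Nat.add_sub_cancel]
  push_cast
  ring

theorem normFanEigen_eq {d : ℕ} {a : EuclideanSpace ℝ (Fin 2)} (ha : a ∈ heisenbergFan (d + 1))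
    (g : Heisenberg (d + 1)) :
    normFanEigen (d + 1) a g =
      Complex.exp (Complex.I * a 0 * g.2) * fanKernel d (fanPoint d ‖g.1‖ a) := by
  by_cases h0 : a 0 = 0
  · simp [normFanEigen_of_eq_zero h0 (nonneg_of_mem_heisenbergFan ha), h0]
  · rcases ha with ha | ha
    · obtain ⟨k, hk⟩ := Set.mem_iUnion.1 ha
      exact normFanEigen_of_mem_fanRay h0 hk g
    · exact absurd ha.1 h0

theorem exists_norm_normFanEigen_le (d : ℕ) : ∃ C : ℝ, ∀ a ∈ heisenbergFan (d + 1),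
    ∀ g : Heisenberg (d + 1),
      ‖normFanEigen (d + 1) a g‖ ≤ C * (1 + a 1 * (‖g.1‖ ^ 2 / 2)) ^ (-12⁻¹ : ℝ) := by
  obtain ⟨C, hC⟩ := exists_abs_fanKernel_le d
  refine ⟨C, fun a ha g => ?_⟩
  have hexp : ‖Complex.exp (Complex.I * a 0 * g.2)‖ = 1 := by simp [Complex.norm_exp]
  rw [normFanEigen_eq ha, norm_mul, hexp, one_mul, Complex.norm_real, Real.norm_eq_abs,
    ← two_mul_snd_fanPoint_add d]
  exact hC _ (fanPoint_mem_kernelRegion _ ha)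

theorem exists_norm_normFanEigen_le_const (d : ℕ) : ∃ C : ℝ, ∀ a ∈ heisenbergFan (d + 1),
    ∀ g : Heisenberg (d + 1), ‖normFanEigen (d + 1) a g‖ ≤ C := by
  obtain ⟨C, hC⟩ := exists_norm_normFanEigen_le d
  refine ⟨|C|, fun a ha g => ?_⟩
  have h1 : 0 ≤ a 1 := nonneg_of_mem_heisenbergFan ha
  calc ‖normFanEigen (d + 1) a g‖ ≤ C * (1 + a 1 * (‖g.1‖ ^ 2 / 2)) ^ (-12⁻¹ : ℝ) := hC a ha g
    _ ≤ |C| * 1 := by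
      gcongr
      · exact le_abs_self C
      · exact Real.rpow_le_one_of_one_le_of_nonpos (le_add_of_nonneg_right (by positivity))
          (by norm_num)
    _ = |C| := mul_one _

theorem tendsto_normFanEigen {d : ℕ} {g : Heisenberg (d + 1)} (hg : g.1 ≠ 0) :
    Tendsto (fun a : heisenbergFan (d + 1) => normFanEigen (d + 1) a g)
      (comap (fun a : heisenbergFan (d + 1) => ‖(a : EuclideanSpace ℝ (Fin 2))‖) atTop)
      (𝓝 0) := by
  obtain ⟨C, hC⟩ := exists_norm_normFanEigen_le d
  have hr : 0 < ‖g.1‖ ^ 2 / 2 := by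
    have := norm_pos_iff.2 hg
    positivity
  refine squeeze_zero_norm (fun a => hC a a.2 g) ?_
  have hbase := tendsto_atTop_add_const_left _ 1
    ((tendsto_apply_one_heisenbergFan d).atTop_mul_const hr)
  simpa using ((tendsto_rpow_neg_atTop (y := (12⁻¹ : ℝ)) (by norm_num)).comp hbase).const_mul C

theorem continuous_normFanEigen {d : ℕ} (g : Heisenberg (d + 1)) :
    Continuous fun a : heisenbergFan (d + 1) => normFanEigen (d + 1) a g := by
  simp only [fun a : heisenbergFan (d + 1) => normFanEigen_eq a.2 g]
  refine Continuous.mul (by fun_prop) (Complex.continuous_ofReal.comp ?_)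
  refine (continuousOn_fanKernel d).comp_continuous ?_ fun a => fanPoint_mem_kernelRegion _ a.2
  unfold fanPoint
  fun_prop

theorem measurable_normFanEigen {d : ℕ} {a : EuclideanSpace ℝ (Fin 2)}
    (ha : a ∈ heisenbergFan (d + 1)) : Measurable (normFanEigen (d + 1) a) := by
  have hcont : Continuous fun g : EuclideanSpace ℂ (Fin (d + 1)) × ℝ =>
      Complex.exp (Complex.I * a 0 * g.2) * fanKernel d (fanPoint d ‖g.1‖ a) := by
    refine Continuous.mul (by fun_prop) (Complex.continuous_ofReal.comp ?_)
    refine (continuousOn_fanKernel d).comp_continuous ?_ fun g => fanPoint_mem_kernelRegion _ ha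
    unfold fanPoint
    fun_prop
  exact funext (normFanEigen_eq ha) ▸ hcont.measurable

theorem measurable_inv_mul_mk {n : ℕ} (z : EuclideanSpace ℂ (Fin n)) (t : ℝ) :
    Measurable fun g : Heisenberg n => g⁻¹ * Heisenberg.mk z t := by
  have hcont : Continuous fun g : EuclideanSpace ℂ (Fin n) × ℝ =>
      (-g.1 + z, -g.2 + t + 1 / 2 * imDot (-g.1) z) := by
    unfold imDot
    fun_prop
  exact hcont.measurable

theorem ae_fst_inv_mul_mk_ne_zero {d : ℕ} (z : EuclideanSpace ℂ (Fin (d + 1))) (t : ℝ) :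
    ∀ᵐ g : Heisenberg (d + 1), (g⁻¹ * Heisenberg.mk z t).1 ≠ 0 := by
  have hfst : ∀ᵐ g : EuclideanSpace ℂ (Fin (d + 1)) × ℝ, g.1 ≠ z :=
    have := Measure.IsAddHaarMeasure.nullSingletonClass
      (volume : Measure (EuclideanSpace ℂ (Fin (d + 1))))
    Measure.quasiMeasurePreserving_fst.ae (Measure.ae_ne volume z)
  exact hfst.mono fun g hg (hzero : -g.1 + z = 0) => hg (neg_add_eq_zero.1 hzero)

theorem normStrichartz_eq_integral {n : ℕ} (f : Heisenberg n → ℂ) (a : EuclideanSpace ℝ (Fin 2))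
    (z : EuclideanSpace ℂ (Fin n)) : normStrichartz f a z =
      ∫ g : Heisenberg n, f g * normFanEigen n a (g⁻¹ * Heisenberg.mk z 0) := by
  have hconst : normStrichartz f a z = fanNormConst n a * strichartz f a z := by
    simp only [normStrichartz, fanNormConst, ite_mul, one_mul]
  simp only [hconst, strichartz, normFanEigen, ← integral_const_mul, mul_left_comm]

section Transform

variable {d : ℕ} {f : Heisenberg (d + 1) → ℂ} (hf : Integrable f)
  (z : EuclideanSpace ℂ (Fin (d + 1)))

include hf

theorem integrable_mul_normFanEigen {a : EuclideanSpace ℝ (Fin 2)}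
    (ha : a ∈ heisenbergFan (d + 1)) :
    Integrable fun g => f g * normFanEigen (d + 1) a (g⁻¹ * Heisenberg.mk z 0) := by
  obtain ⟨C, hC⟩ := exists_norm_normFanEigen_le_const d
  exact hf.mul_bdd
    ((measurable_normFanEigen ha).comp (measurable_inv_mul_mk z 0)).aestronglyMeasurable
    (.of_forall fun g => hC a ha _)

theorem integrable_mul_fanEigen {a : EuclideanSpace ℝ (Fin 2)} (ha : a ∈ heisenbergFan (d + 1)) :
    Integrable fun g => f g * fanEigen (d + 1) a (g⁻¹ * Heisenberg.mk z 0) := by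
  refine ((integrable_mul_normFanEigen hf z ha).const_mul (fanNormConst (d + 1) a)⁻¹).congr ?_
  filter_upwards with g
  rw [normFanEigen, mul_left_comm, inv_mul_cancel_left₀ (fanNormConst_ne_zero _ a)]

theorem exists_integrable_norm_mul_normFanEigen_le : ∃ F : Heisenberg (d + 1) → ℝ, Integrable F ∧
    ∀ (a : heisenbergFan (d + 1)) (g : Heisenberg (d + 1)),
      ‖f g * normFanEigen (d + 1) a (g⁻¹ * Heisenberg.mk z 0)‖ ≤ F g := by
  obtain ⟨C, hC⟩ := exists_norm_normFanEigen_le_const d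
  refine ⟨_, hf.norm.mul_const C, fun a g => ?_⟩
  rw [norm_mul]
  gcongr
  exact hC a a.2 _

theorem continuous_normStrichartz :
    Continuous fun a : heisenbergFan (d + 1) => normStrichartz f a z := by
  obtain ⟨F, hF, hle⟩ := exists_integrable_norm_mul_normFanEigen_le hf z
  simp only [normStrichartz_eq_integral]
  exact continuous_of_dominated (fun a => (integrable_mul_normFanEigen hf z a.2).1)
    (fun a => .of_forall (hle a)) hF
    (.of_forall fun _ => continuous_const.mul (continuous_normFanEigen _))

theorem tendsto_normStrichartz :
    Tendsto (fun a : heisenbergFan (d + 1) => normStrichartz f a z)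
      (comap (fun a : heisenbergFan (d + 1) => ‖(a : EuclideanSpace ℝ (Fin 2))‖) atTop)
      (𝓝 0) := by
  obtain ⟨F, hF, hle⟩ := exists_integrable_norm_mul_normFanEigen_le hf z
  simp only [normStrichartz_eq_integral]
  rw [← integral_zero (Heisenberg (d + 1)) ℂ]
  refine tendsto_integral_filter_of_dominated_convergence F
    (.of_forall fun a => (integrable_mul_normFanEigen hf z a.2).1)
    (.of_forall fun a => .of_forall (hle a)) hF ?_
  filter_upwards [ae_fst_inv_mul_mk_ne_zero z 0] with g hg
  simpa using (tendsto_normFanEigen hg).const_mul (f g)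

end Transform

end

theorem theorem1p1 (n : ℕ) (hn : 1 ≤ n) (f : Heisenberg n → ℂ) (hf : Integrable f volume)
    (z : EuclideanSpace ℂ (Fin n)) :
    (∀ a ∈ heisenbergFan n,
      Integrable (fun g : Heisenberg n => f g * fanEigen n a (g⁻¹ * Heisenberg.mk z 0))
        volume) ∧
    UniformContinuous (fun a : heisenbergFan n => normStrichartz f a z) ∧
    Tendsto (fun a : heisenbergFan n => normStrichartz f a z)
      (comap (fun a : heisenbergFan n => ‖(a : EuclideanSpace ℝ (Fin 2))‖) atTop) (𝓝 0) := by
  obtain ⟨d, rfl⟩ := Nat.exists_eq_add_of_le' hn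
  have hlim := tendsto_normStrichartz hf z
  exact ⟨fun a ha => integrable_mul_fanEigen hf z ha,
    (continuous_normStrichartz hf z).uniformContinuous_of_tendsto_cocompact
      (hlim.mono_left (cocompact_heisenbergFan_le (d + 1))), hlim⟩
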